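/- Let $S_n$ be the symmetric group on $\{1,\dots,n\}$, with simple transpositions $s_j=(j,j+1)$ for $1\le j\le n-1$, length function $\ell$, right descent sets $D_R(v)=\{s_j : \ell(vs_j)<\ell(v)\}$, identity $e$, and the Bruhat order $\le$. Products of permutations are compositions of functions, so $vs_j$ is obtained from the one-line notation of $v$ by exchanging the entries in positions $j$ and $j+1$. Let $\widetilde R_{u,v}(q)\in\mathbb Z[q]$, for $u,v\in S_n$, be the Kazhdan–Lusztig $\widetilde R$-polynomials, i.e. the unique family of polynomials such that $\widetilde R_{u,v}(q)=0$ if $u\not\le v$, $\widetilde R_{v,v}(q)=1$, and, whenever $u\le v$ and $s\in D_R(v)$, $$\widetilde R_{u,v}(q)=\begin{cases}\widetilde R_{us,vs}(q), & s\in D_R(u),\\ \widetilde R_{us,vs}(q)+q\,\widetilde R_{u,vs}(q), & s\notin D_R(u).\end{cases}$$ Let $F_m(q)$ be the $q$-Fibonacci numbers: $F_0(q)=F_1(q)=1$ and $F_m(q)=F_{m-1}(q)+qF_{m-2}(q)$ for $m\ge 2$. **Theorem.** Let $n\ge 3$ and $2\le i\le n-1$, and let $v_{n,i}\in S_n$ be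 the permutation with one-line notation $3\,4\cdots i\;n\;(i+1)\cdots(n-1)\;1\,2$, where the segment $3\,4\cdots i$ is empty if $i=2$ and the segment $(i+1)\cdots(n-1)$ is empty if $i=n-1$. Then $$\widetilde R_{e,v_{n,i}}(q)=\sum_{k=0}^{n-i-1}q^{3n-i-2k-5}\binom{n-i-1}{k}F_{n-k-2}(q^{-2}).$$ -/

import Mathlib

namespace KLRTilde

open Polynomial

/-- The simple transposition `s_{j+1} = (j+1, j+2)` of the symmetric group `S_n`.  The set
`{1, …, n}` is modelled by `Fin n = {0, …, n-1}`; the index `j` runs through `{0, …, n-2}`. -/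
def simple {n : ℕ} (j : Fin (n - 1)) : Equiv.Perm (Fin n) :=
  Equiv.swap ⟨j, by omega⟩ ⟨j + 1, by omega⟩

/-- The product `s_{j_1} s_{j_2} ⋯ s_{j_k}` of a word in the simple transpositions; the product
of permutations is composition of functions, so `π * simple j` exchanges the entries of the
one-line notation of `π` in two adjacent positions. -/
def wordProd {n : ℕ} (w : List (Fin (n - 1))) : Equiv.Perm (Fin n) := (w.map simple).prod

/-- The length `ℓ(π)`: the minimal number of simple transpositions in an expression of `π`. -/
noncomputable def length {n : ℕ} (π : Equiv.Perm (Fin n)) : ℕ :=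
  sInf {k | ∃ w : List (Fin (n - 1)), w.length = k ∧ wordProd w = π}

/-- `w` is a reduced expression of `π`. -/
def IsReducedExpr {n : ℕ} (w : List (Fin (n - 1))) (π : Equiv.Perm (Fin n)) : Prop :=
  wordProd w = π ∧ w.length = length π

/-- `s_j` is a right descent of `π`, i.e. `s_j ∈ D_R(π)`. -/
def IsDescent {n : ℕ} (π : Equiv.Perm (Fin n)) (j : Fin (n - 1)) : Prop :=
  length (π * simple j) < length π

/-- The Bruhat order on `S_n`: every reduced expression of `v` has a subword that is a reduced
expression of `u`. -/
def BruhatLE {n : ℕ} (u v : Equiv.Perm (Fin n)) : Prop :=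
  ∀ w, IsReducedExpr w v → ∃ w', w'.Sublist w ∧ IsReducedExpr w' u

/-- The defining properties of the family of Kazhdan-Lusztig `R̃`-polynomials of `S_n`. -/
structure IsRTildeFamily {n : ℕ}
    (R : Equiv.Perm (Fin n) → Equiv.Perm (Fin n) → ℤ[X]) : Prop where
  eq_zero : ∀ u v, ¬ BruhatLE u v → R u v = 0
  self : ∀ v, R v v = 1
  of_descent : ∀ u v j, BruhatLE u v → IsDescent v j → IsDescent u j →
    R u v = R (u * simple j) (v * simple j)
  of_not_descent : ∀ u v j, BruhatLE u v → IsDescent v j → ¬ IsDescent u j →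
    R u v = R (u * simple j) (v * simple j) + X * R u (v * simple j)

/-! The rest of this namespace proves that there is exactly one such family, and names it. -/

section Length

variable {n : ℕ}

/-- The left of the two points exchanged by `simple j`. -/
def lo (j : Fin (n - 1)) : Fin n := ⟨j, by omega⟩

/-- The right of the two points exchanged by `simple j`. -/
def hi (j : Fin (n - 1)) : Fin n := ⟨j + 1, by omega⟩

theorem simple_eq (j : Fin (n - 1)) : simple j = Equiv.swap (lo j) (hi j) := rfl

theorem lo_lt_hi (j : Fin (n - 1)) : lo j < hi j := by simp [lo, hi, Fin.lt_def]

theorem simple_lo (j : Fin (n - 1)) : simple j (lo j) = hi j := Equiv.swap_apply_left _ _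

theorem simple_hi (j : Fin (n - 1)) : simple j (hi j) = lo j := Equiv.swap_apply_right _ _

theorem simple_mul_self (j : Fin (n - 1)) : simple j * simple j = 1 := Equiv.swap_mul_self _ _

theorem simple_inv (j : Fin (n - 1)) : (simple j)⁻¹ = simple j := Equiv.swap_inv _ _

theorem mul_simple_cancel (u : Equiv.Perm (Fin n)) (j : Fin (n - 1)) :
    u * simple j * simple j = u := by rw [mul_assoc, simple_mul_self, mul_one]

theorem simple_mul_cancel (u : Equiv.Perm (Fin n)) (j : Fin (n - 1)) :
    simple j * (simple j * u) = u := by rw [← mul_assoc, simple_mul_self, one_mul]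

theorem wordProd_nil : wordProd ([] : List (Fin (n - 1))) = 1 := rfl

theorem wordProd_cons (j : Fin (n - 1)) (w) : wordProd (j :: w) = simple j * wordProd w := by
  simp [wordProd]

theorem wordProd_append (a b : List (Fin (n - 1))) :
    wordProd (a ++ b) = wordProd a * wordProd b := by
  simp [wordProd]

theorem wordProd_concat (w) (j : Fin (n - 1)) : wordProd (w ++ [j]) = wordProd w * simple j := by
  simp [wordProd]

theorem wordProd_reverse (w : List (Fin (n - 1))) : wordProd w.reverse = (wordProd w)⁻¹ := by
  induction w with
  | nil => rfl
  | cons j w ih =>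
    rw [List.reverse_cons, wordProd_concat, wordProd_cons, ih, mul_inv_rev, simple_inv]

theorem exists_word (π : Equiv.Perm (Fin n)) : ∃ w, wordProd w = π := by
  obtain _ | m := n
  · exact ⟨[], Subsingleton.elim _ _⟩
  have h : π ∈ Submonoid.closure
      (Set.range fun i : Fin m ↦ Equiv.swap i.castSucc i.succ) := by
    rw [Equiv.Perm.mclosure_swap_castSucc_succ]; trivial
  induction h using Submonoid.closure_induction with
  | mem x hx =>
    obtain ⟨i, rfl⟩ := hx
    exact ⟨[i], by simp only [wordProd, List.map_cons, List.map_nil, List.prod_singleton]; rfl⟩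
  | one => exact ⟨[], rfl⟩
  | mul x y _ _ hx hy =>
    obtain ⟨a, rfl⟩ := hx
    obtain ⟨b, rfl⟩ := hy
    exact ⟨a ++ b, wordProd_append a b⟩

theorem exists_reduced (π : Equiv.Perm (Fin n)) : ∃ w, IsReducedExpr w π := by
  have h : {k | ∃ w : List (Fin (n - 1)), w.length = k ∧ wordProd w = π}.Nonempty := by
    obtain ⟨w, hw⟩ := exists_word π
    exact ⟨_, w, rfl, hw⟩
  obtain ⟨w, h1, h2⟩ := Nat.sInf_mem h
  exact ⟨w, h2, h1⟩

theorem length_le (w : List (Fin (n - 1))) : length (wordProd w) ≤ w.length :=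
  Nat.sInf_le ⟨w, rfl, rfl⟩

theorem length_inv (π : Equiv.Perm (Fin n)) : length π⁻¹ = length π := by
  have key : ∀ π : Equiv.Perm (Fin n), length π⁻¹ ≤ length π := fun π ↦ by
    obtain ⟨w, h1, h2⟩ := exists_reduced π
    rw [← h2, ← h1, ← wordProd_reverse, ← List.length_reverse]
    exact length_le _
  exact le_antisymm (key π) (by simpa using key π⁻¹)

theorem length_mul_simple_le (π : Equiv.Perm (Fin n)) (j) :
    length (π * simple j) ≤ length π + 1 := by
  obtain ⟨w, h1, h2⟩ := exists_reduced π
  rw [← h2, ← h1, ← wordProd_concat]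
  simpa using length_le (w ++ [j])

/-- A simple transposition reverses the order of `lo j` and `hi j`, and of no other pair. -/
theorem simple_lt_simple (j : Fin (n - 1)) {a b : Fin n} (hab : a < b)
    (h : ¬ (a = lo j ∧ b = hi j)) : simple j a < simple j b := by
  simp only [simple, Equiv.swap_apply_def, lo, hi, Fin.ext_iff, Fin.lt_def] at *
  split_ifs <;> simp <;> omega

/-- The exchange property. -/
theorem exchange (j : Fin (n - 1)) (w : List (Fin (n - 1)))
    (h : wordProd w (hi j) < wordProd w (lo j)) :
    ∃ w', w'.Sublist w ∧ w'.length + 1 = w.length ∧ wordProd w' = wordProd w * simple j := by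
  induction w with
  | nil => exact absurd h (by simpa [wordProd_nil] using (lo_lt_hi j).le)
  | cons a w ih =>
    rcases lt_trichotomy (wordProd w (hi j)) (wordProd w (lo j)) with h1 | h1 | h1
    · obtain ⟨w', hs, hl, hp⟩ := ih h1
      exact ⟨a :: w', hs.cons_cons a, by simp [hl], by rw [wordProd_cons, wordProd_cons, hp, mul_assoc]⟩
    · exact absurd ((wordProd w).injective h1) (lo_lt_hi j).ne'
    · refine ⟨w, List.sublist_cons_self a w, rfl, ?_⟩
      have h2 : wordProd w (lo j) = lo a ∧ wordProd w (hi j) = hi a := by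
        by_contra hc
        have h3 := simple_lt_simple a h1 hc
        rw [wordProd_cons, Equiv.Perm.mul_apply, Equiv.Perm.mul_apply] at h
        exact absurd h h3.not_gt
      have h4 : wordProd w * simple j = simple a * wordProd w := by
        rw [simple_eq, simple_eq, Equiv.mul_swap_eq_swap_mul, h2.1, h2.2]
      rw [wordProd_cons, ← h4, mul_simple_cancel]

theorem length_lt_of_lt {π : Equiv.Perm (Fin n)} {j} (h : π (hi j) < π (lo j)) :
    length (π * simple j) < length π := by
  obtain ⟨w, rfl, h2⟩ := exists_reduced π
  obtain ⟨w', _, hl, hp⟩ := exchange j w h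
  have := length_le w'
  rw [hp] at this
  omega

theorem lt_length_of_lt {π : Equiv.Perm (Fin n)} {j} (h : π (lo j) < π (hi j)) :
    length π < length (π * simple j) := by
  have := length_lt_of_lt (π := π * simple j) (j := j)
    (by simpa [Equiv.Perm.mul_apply, simple_lo, simple_hi] using h)
  rwa [mul_simple_cancel] at this

theorem isDescent_iff (π : Equiv.Perm (Fin n)) (j) : IsDescent π j ↔ π (hi j) < π (lo j) := by
  refine ⟨fun h ↦ ?_, length_lt_of_lt⟩
  by_contra hc
  rcases (not_lt.mp hc).lt_or_eq with h1 | h1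
  · exact absurd h (lt_length_of_lt h1).not_gt
  · exact absurd (π.injective h1) (lo_lt_hi j).ne

theorem lt_iff_not (π : Equiv.Perm (Fin n)) (j) : π (lo j) < π (hi j) ↔ ¬ π (hi j) < π (lo j) := by
  rw [not_lt]
  exact ⟨le_of_lt, fun h ↦ lt_of_le_of_ne h fun h1 ↦ (lo_lt_hi j).ne (π.injective h1)⟩

theorem IsReducedExpr.concat {w : List (Fin (n - 1))} {v : Equiv.Perm (Fin n)} {j}
    (hw : IsReducedExpr w (v * simple j)) (h : IsDescent v j) : IsReducedExpr (w ++ [j]) v := by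
  refine ⟨by rw [wordProd_concat, hw.1, mul_simple_cancel], ?_⟩
  have h1 := length_mul_simple_le (v * simple j) j
  rw [mul_simple_cancel] at h1
  have h2 : length (v * simple j) < length v := h
  have := hw.2
  simp; omega

theorem IsReducedExpr.of_concat {w : List (Fin (n - 1))} {v : Equiv.Perm (Fin n)} {j}
    (hw : IsReducedExpr (w ++ [j]) v) : IsReducedExpr w (v * simple j) ∧ IsDescent v j := by
  have h1 : wordProd w = v * simple j := by
    rw [← hw.1, wordProd_concat, mul_simple_cancel]
  have h2 := length_le w
  rw [h1] at h2
  have h3 := length_mul_simple_le (v * simple j) j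
  rw [mul_simple_cancel] at h3
  have h4 := hw.2
  simp at h4
  exact ⟨⟨h1, by omega⟩, show length (v * simple j) < length v by omega⟩

theorem IsReducedExpr.reverse {w : List (Fin (n - 1))} {v : Equiv.Perm (Fin n)}
    (hw : IsReducedExpr w v) : IsReducedExpr w.reverse v⁻¹ :=
  ⟨by rw [wordProd_reverse, hw.1], by rw [List.length_reverse, hw.2, length_inv]⟩

theorem IsReducedExpr.of_cons {w : List (Fin (n - 1))} {v : Equiv.Perm (Fin n)} {j}
    (hw : IsReducedExpr (j :: w) v) :
    IsReducedExpr w (simple j * v) ∧ v⁻¹ (hi j) < v⁻¹ (lo j) := by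
  have h := hw.reverse
  rw [List.reverse_cons] at h
  obtain ⟨h1, h2⟩ := h.of_concat
  refine ⟨?_, (isDescent_iff _ _).mp h2⟩
  have := h1.reverse
  rwa [List.reverse_reverse, mul_inv_rev, inv_inv, simple_inv] at this

end Length

section Operators

variable {n : ℕ}

/-- The operator `(τ_j f)(u) = f(u s_j) - [u s_j < u] q f(u)`. -/
noncomputable def tau (j : Fin (n - 1)) : Module.End ℤ[X] (Equiv.Perm (Fin n) → ℤ[X]) where
  toFun f u := f (u * simple j) - if u (hi j) < u (lo j) then X * f u else 0
  map_add' f g := by funext u; simp only [Pi.add_apply]; split_ifs <;> ring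
  map_smul' c f := by
    funext u; simp only [Pi.smul_apply, smul_eq_mul, RingHom.id_apply]; split_ifs <;> ring

/-- The operator `(μ_j f)(u) = f(s_j u) - [s_j u < u] q f(u)`. -/
noncomputable def mu (j : Fin (n - 1)) : Module.End ℤ[X] (Equiv.Perm (Fin n) → ℤ[X]) where
  toFun f u := f (simple j * u) - if u⁻¹ (hi j) < u⁻¹ (lo j) then X * f u else 0
  map_add' f g := by funext u; simp only [Pi.add_apply]; split_ifs <;> ring
  map_smul' c f := by
    funext u; simp only [Pi.smul_apply, smul_eq_mul, RingHom.id_apply]; split_ifs <;> ring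

/-- The operator `(σ_j f)(u) = f(u s_j) + [u s_j > u] q f(u)`. -/
noncomputable def sigma (j : Fin (n - 1)) : Module.End ℤ[X] (Equiv.Perm (Fin n) → ℤ[X]) where
  toFun f u := f (u * simple j) + if u (hi j) < u (lo j) then 0 else X * f u
  map_add' f g := by funext u; simp only [Pi.add_apply]; split_ifs <;> ring
  map_smul' c f := by
    funext u; simp only [Pi.smul_apply, smul_eq_mul, RingHom.id_apply]; split_ifs <;> ring

theorem tau_apply (j : Fin (n - 1)) (f : Equiv.Perm (Fin n) → ℤ[X]) (u) :
    tau j f u = f (u * simple j) - if u (hi j) < u (lo j) then X * f u else 0 := rfl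

theorem mu_apply (j : Fin (n - 1)) (f : Equiv.Perm (Fin n) → ℤ[X]) (u) :
    mu j f u = f (simple j * u) - if u⁻¹ (hi j) < u⁻¹ (lo j) then X * f u else 0 := rfl

theorem sigma_apply (j : Fin (n - 1)) (f : Equiv.Perm (Fin n) → ℤ[X]) (u) :
    sigma j f u = f (u * simple j) + if u (hi j) < u (lo j) then 0 else X * f u := rfl

theorem flip_iff (u : Equiv.Perm (Fin n)) (j) :
    (u * simple j) (hi j) < (u * simple j) (lo j) ↔ ¬ u (hi j) < u (lo j) := by
  rw [Equiv.Perm.mul_apply, Equiv.Perm.mul_apply, simple_lo, simple_hi, lt_iff_not]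

theorem tau_sigma (j : Fin (n - 1)) : tau (n := n) j * sigma j = 1 := by
  refine LinearMap.ext fun f ↦ funext fun u ↦ ?_
  rw [Module.End.mul_apply, tau_apply, sigma_apply, sigma_apply, mul_simple_cancel]
  simp only [flip_iff, Module.End.one_apply]
  by_cases h : u (hi j) < u (lo j) <;> simp [h]

theorem sigma_tau (j : Fin (n - 1)) : sigma (n := n) j * tau j = 1 := by
  refine LinearMap.ext fun f ↦ funext fun u ↦ ?_
  rw [Module.End.mul_apply, sigma_apply, tau_apply, tau_apply, mul_simple_cancel]
  simp only [flip_iff, Module.End.one_apply]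
  by_cases h : u (hi j) < u (lo j) <;> simp [h]

/-- Left multiplication by `s_a` changes the descent at `b` only if `s_a u = u s_b`. -/
theorem descent_left (u : Equiv.Perm (Fin n)) (a b) (h : simple a * u ≠ u * simple b) :
    (simple a * u) (hi b) < (simple a * u) (lo b) ↔ u (hi b) < u (lo b) := by
  have key : ∀ x y : Fin n, u x = lo a → u y = hi a → (x = lo b ∧ y = hi b) ∨
      (x = hi b ∧ y = lo b) → False := by
    rintro x y hx hy (⟨rfl, rfl⟩ | ⟨rfl, rfl⟩) <;> apply h
    · rw [simple_eq, simple_eq, Equiv.mul_swap_eq_swap_mul, hx, hy]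
    · rw [simple_eq, simple_eq, Equiv.mul_swap_eq_swap_mul, hx, hy, Equiv.swap_comm]
  rw [Equiv.Perm.mul_apply, Equiv.Perm.mul_apply]
  constructor
  · intro h1
    by_contra h2
    rw [← lt_iff_not] at h2
    exact absurd h1 (simple_lt_simple a h2
      fun hc ↦ key _ _ hc.1 hc.2 (Or.inl ⟨rfl, rfl⟩)).not_gt
  · exact fun h1 ↦ simple_lt_simple a h1 fun hc ↦ key _ _ hc.1 hc.2 (Or.inr ⟨rfl, rfl⟩)

theorem descent_right (u : Equiv.Perm (Fin n)) (a b) (h : simple a * u ≠ u * simple b) :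
    (u * simple b)⁻¹ (hi a) < (u * simple b)⁻¹ (lo a) ↔ u⁻¹ (hi a) < u⁻¹ (lo a) := by
  have := descent_left u⁻¹ b a fun hc ↦ h <| by
    have h1 := congrArg (·⁻¹) hc
    simp only [mul_inv_rev, inv_inv, simple_inv] at h1
    exact h1.symm
  rwa [mul_inv_rev, simple_inv]

theorem commute_tau_mu (a b : Fin (n - 1)) : Commute (tau (n := n) b) (mu a) := by
  refine LinearMap.ext fun f ↦ funext fun u ↦ ?_
  rw [Module.End.mul_apply, Module.End.mul_apply, tau_apply, mu_apply, mu_apply, mu_apply,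
    tau_apply, tau_apply]
  by_cases h : simple a * u = u * simple b
  · have h1 : (u⁻¹ (hi a) < u⁻¹ (lo a)) ↔ u (hi b) < u (lo b) := by
      rw [← isDescent_iff, ← isDescent_iff, IsDescent, IsDescent, ← h, length_inv,
        ← length_inv (u⁻¹ * simple a), mul_inv_rev, inv_inv, simple_inv]
    have h2 : ((u * simple b)⁻¹ (hi a) < (u * simple b)⁻¹ (lo a)) ↔ ¬ u (hi b) < u (lo b) := by
      rw [← h, mul_inv_rev, simple_inv, flip_iff, h1]
    simp only [← mul_assoc, h, h1, h2, flip_iff]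
  · rw [if_congr (descent_left u a b h) rfl rfl, if_congr (descent_right u a b h) rfl rfl,
      mul_assoc]
    split_ifs <;> ring

/-- The point mass at `w`. -/
noncomputable def pt (w : Equiv.Perm (Fin n)) : Equiv.Perm (Fin n) → ℤ[X] := Pi.single w 1

theorem tau_pt {w : Equiv.Perm (Fin n)} {j} (h : w (lo j) < w (hi j)) :
    tau j (pt w) = pt (w * simple j) := by
  funext u
  rw [tau_apply, pt, pt, Pi.single_apply, Pi.single_apply, Pi.single_apply]
  have h1 : u * simple j = w ↔ u = w * simple j :=
    ⟨fun h ↦ by rw [← h, mul_simple_cancel], fun h ↦ by rw [h, mul_simple_cancel]⟩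
  rw [if_congr h1 rfl rfl]
  by_cases h2 : u = w
  · subst h2; rw [if_neg h.not_gt, sub_zero]
  · simp [h2]

theorem mu_pt {w : Equiv.Perm (Fin n)} {j} (h : w⁻¹ (lo j) < w⁻¹ (hi j)) :
    mu j (pt w) = pt (simple j * w) := by
  funext u
  rw [mu_apply, pt, pt, Pi.single_apply, Pi.single_apply, Pi.single_apply]
  have h1 : simple j * u = w ↔ u = simple j * w :=
    ⟨fun h ↦ by rw [← h, simple_mul_cancel], fun h ↦ by rw [h, simple_mul_cancel]⟩
  rw [if_congr h1 rfl rfl]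
  by_cases h2 : u = w
  · subst h2; rw [if_neg h.not_gt, sub_zero]
  · simp [h2]

theorem prod_tau_pt (a : List (Fin (n - 1))) : ∀ v, IsReducedExpr a v →
    (a.map (tau (n := n))).prod (pt 1) = pt v⁻¹ := by
  induction a with
  | nil => intro v hv; rw [← hv.1]; rfl
  | cons j a ih =>
    intro v hv
    obtain ⟨h1, h2⟩ := hv.of_cons
    rw [List.map_cons, List.prod_cons, Module.End.mul_apply, ih _ h1, tau_pt, mul_inv_rev,
      simple_inv, mul_simple_cancel]
    rw [mul_inv_rev, simple_inv, Equiv.Perm.mul_apply, Equiv.Perm.mul_apply, simple_lo, simple_hi]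
    exact h2

theorem prod_mu_pt (a : List (Fin (n - 1))) : ∀ v, IsReducedExpr a v →
    (a.map (mu (n := n))).prod (pt 1) = pt v := by
  induction a with
  | nil => intro v hv; rw [← hv.1]; rfl
  | cons j a ih =>
    intro v hv
    obtain ⟨h1, h2⟩ := hv.of_cons
    rw [List.map_cons, List.prod_cons, Module.End.mul_apply, ih _ h1, mu_pt, simple_mul_cancel]
    rw [mul_inv_rev, simple_inv, Equiv.Perm.mul_apply, Equiv.Perm.mul_apply, simple_lo, simple_hi]
    exact h2

theorem prod_tau_eq {a b : List (Fin (n - 1))} {v} (ha : IsReducedExpr a v)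
    (hb : IsReducedExpr b v) : (a.map (tau (n := n))).prod = (b.map tau).prod := by
  have hc : ∀ c w : List (Fin (n - 1)),
      Commute (c.map (tau (n := n))).prod (w.map mu).prod := fun c w ↦ by
    refine Commute.list_prod_left _ _ fun x hx ↦ Commute.list_prod_right _ _ fun y hy ↦ ?_
    obtain ⟨i, _, rfl⟩ := List.mem_map.mp hx
    obtain ⟨j, _, rfl⟩ := List.mem_map.mp hy
    exact commute_tau_mu j i
  have key : ∀ w, (a.map (tau (n := n))).prod (pt w) = (b.map tau).prod (pt w) := fun w ↦ by
    obtain ⟨c, hw⟩ := exists_reduced w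
    rw [← prod_mu_pt c w hw, ← Module.End.mul_apply, ← Module.End.mul_apply, (hc a c).eq,
      (hc b c).eq, Module.End.mul_apply, Module.End.mul_apply, prod_tau_pt a v ha,
      prod_tau_pt b v hb]
  refine LinearMap.pi_ext' fun w ↦ LinearMap.ext_ring ?_
  exact key w

/-- The operator `σ_{j_k} ⋯ σ_{j_1}` of a word `j_1 ⋯ j_k`. -/
noncomputable def sigmaWord (a : List (Fin (n - 1))) :
    Module.End ℤ[X] (Equiv.Perm (Fin n) → ℤ[X]) := (a.reverse.map sigma).prod

theorem sigmaWord_concat (a : List (Fin (n - 1))) (j) :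
    sigmaWord (a ++ [j]) = sigma j * sigmaWord a := by simp [sigmaWord]

theorem sigmaWord_cons (a : List (Fin (n - 1))) (j) :
    sigmaWord (j :: a) = sigmaWord a * sigma j := by simp [sigmaWord]

theorem tau_sigmaWord (a : List (Fin (n - 1))) : (a.map tau).prod * sigmaWord a = 1 := by
  induction a using List.reverseRecOn with
  | nil => simp [sigmaWord]
  | append_singleton a j ih =>
    rw [sigmaWord_concat, List.map_append, List.prod_append, List.map_singleton,
      List.prod_singleton, mul_assoc, ← mul_assoc (tau j), tau_sigma, one_mul, ih]

theorem sigmaWord_tau (a : List (Fin (n - 1))) : sigmaWord a * (a.map tau).prod = 1 := by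
  induction a with
  | nil => simp [sigmaWord]
  | cons j a ih =>
    rw [sigmaWord_cons, List.map_cons, List.prod_cons, mul_assoc, ← mul_assoc (sigma j),
      sigma_tau, one_mul, ih]

theorem sigmaWord_eq {a b : List (Fin (n - 1))} {v} (ha : IsReducedExpr a v)
    (hb : IsReducedExpr b v) : sigmaWord a = sigmaWord b := by
  calc sigmaWord a = sigmaWord a * ((b.map tau).prod * sigmaWord b) := by
        rw [tau_sigmaWord, mul_one]
    _ = sigmaWord b := by rw [← prod_tau_eq ha hb, ← mul_assoc, sigmaWord_tau, one_mul]

end Operators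

section Existence

variable {n : ℕ}

theorem sigmaWord_self (a : List (Fin (n - 1))) : ∀ v, IsReducedExpr a v →
    sigmaWord a (pt 1) v = 1 := by
  induction a using List.reverseRecOn with
  | nil => intro v hv; rw [← hv.1]; simp [sigmaWord, pt, wordProd_nil]
  | append_singleton a j ih =>
    intro v hv
    obtain ⟨h1, h2⟩ := hv.of_concat
    rw [sigmaWord_concat, Module.End.mul_apply, sigma_apply, ih _ h1,
      if_pos ((isDescent_iff _ _).mp h2), add_zero]

theorem sigmaWord_support (a : List (Fin (n - 1))) : ∀ u, sigmaWord a (pt 1) u ≠ 0 →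
    ∃ w', w'.Sublist a ∧ IsReducedExpr w' u := by
  induction a using List.reverseRecOn with
  | nil =>
    intro u hu
    refine ⟨[], List.Sublist.refl _, ?_⟩
    have h : u = 1 := by
      by_contra h
      exact hu (by simp [sigmaWord, pt, h])
    have := length_le ([] : List (Fin (n - 1)))
    rw [wordProd_nil] at this
    rw [h]
    exact ⟨rfl, (Nat.le_zero.mp this).symm⟩
  | append_singleton a j ih =>
    intro u hu
    rw [sigmaWord_concat, Module.End.mul_apply, sigma_apply] at hu
    have hsub : ∀ w : List (Fin (n - 1)), w.Sublist a → w.Sublist (a ++ [j]) :=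
      fun w hw ↦ hw.trans (List.sublist_append_left a [j])
    by_cases h : u (hi j) < u (lo j)
    · rw [if_pos h, add_zero] at hu
      obtain ⟨w, hs, hr⟩ := ih _ hu
      exact ⟨w ++ [j], hs.append (List.Sublist.refl _), hr.concat ((isDescent_iff _ _).mpr h)⟩
    · rw [if_neg h] at hu
      by_cases h0 : sigmaWord a (pt 1) u = 0
      · rw [h0, mul_zero, add_zero] at hu
        obtain ⟨w, hs, hr⟩ := ih _ hu
        obtain ⟨w', hs', hl, hp⟩ := exchange j w (by rw [hr.1]; exact (flip_iff u j).mpr h)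
        rw [hr.1, mul_simple_cancel] at hp
        refine ⟨w', hsub _ (hs'.trans hs), hp, ?_⟩
        have h1 := length_le w'
        rw [hp] at h1
        have h2 := length_mul_simple_le u j
        have h3 := hr.2
        omega
      · obtain ⟨w, hs, hr⟩ := ih _ h0
        exact ⟨w, hsub _ hs, hr⟩

theorem exists_isRTildeFamily (n : ℕ) :
    ∃ R : Equiv.Perm (Fin n) → Equiv.Perm (Fin n) → ℤ[X], IsRTildeFamily R := by
  choose word hword using fun v : Equiv.Perm (Fin n) ↦ exists_reduced v
  have step : ∀ v j, IsDescent v j →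
      sigmaWord (word v) = sigma j * sigmaWord (word (v * simple j)) := fun v j h ↦ by
    rw [← sigmaWord_concat]
    exact sigmaWord_eq (hword v) ((hword _).concat h)
  refine ⟨fun u v ↦ sigmaWord (word v) (pt 1) u, ?_, ?_, ?_, ?_⟩
  · intro u v h
    by_contra h0
    refine h fun w hw ↦ ?_
    rw [sigmaWord_eq (hword v) hw] at h0
    exact sigmaWord_support w u h0
  · exact fun v ↦ sigmaWord_self _ _ (hword v)
  · intro u v j _ hv hu
    simp only [step v j hv]
    rw [Module.End.mul_apply, sigma_apply, if_pos ((isDescent_iff _ _).mp hu), add_zero]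
  · intro u v j _ hv hu
    simp only [step v j hv]
    rw [Module.End.mul_apply, sigma_apply, if_neg (mt (isDescent_iff _ _).mpr hu)]

theorem IsRTildeFamily.unique {R R' : Equiv.Perm (Fin n) → Equiv.Perm (Fin n) → ℤ[X]}
    (h : IsRTildeFamily R) (h' : IsRTildeFamily R') : R = R' := by
  have key : ∀ k v, length v = k → ∀ u, R u v = R' u v := by
    intro k
    induction k using Nat.strong_induction_on with
    | _ k ih =>
      rintro v rfl u
      by_cases hle : BruhatLE u v
      · obtain ⟨w, hw⟩ := exists_reduced v
        rcases List.eq_nil_or_concat w with rfl | ⟨w, j, rfl⟩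
        · obtain ⟨w', hs, hr⟩ := hle _ hw
          rw [List.sublist_nil] at hs
          subst hs
          rw [← hr.1, ← hw.1, h.self, h'.self]
        · have hv := (IsReducedExpr.of_concat (by simpa using hw)).2
          by_cases hu : IsDescent u j
          · rw [h.of_descent u v j hle hv hu, h'.of_descent u v j hle hv hu, ih _ hv _ rfl]
          · rw [h.of_not_descent u v j hle hv hu, h'.of_not_descent u v j hle hv hu,
              ih _ hv _ rfl, ih _ hv _ rfl]
      · rw [h.eq_zero u v hle, h'.eq_zero u v hle]
  funext u v
  exact key _ v rfl u

theorem existsUnique_isRTildeFamily (n : ℕ) :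
    ∃! R : Equiv.Perm (Fin n) → Equiv.Perm (Fin n) → ℤ[X], IsRTildeFamily R := by
  obtain ⟨R, h⟩ := exists_isRTildeFamily n
  exact ⟨R, h, fun R' h' ↦ h'.unique h⟩

end Existence

/-- The Kazhdan-Lusztig `R̃`-polynomial `R̃_{u,v}(q)`, as a polynomial in `q = X`: the value at
`u, v` of the unique family with the properties in `IsRTildeFamily`. -/
noncomputable def RTilde {n : ℕ} (u v : Equiv.Perm (Fin n)) : ℤ[X] :=
  (existsUnique_isRTildeFamily n).exists.choose u v

/-- The `q`-Fibonacci numbers: `F_0 = F_1 = 1` and `F_m = F_{m-1} + q F_{m-2}`, with `q = X`. -/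
noncomputable def qFib : ℕ → ℤ[X]
  | 0 => 1
  | 1 => 1
  | m + 2 => qFib (m + 1) + X * qFib m

/-- The entries of `v_{n,i} = 3 4 ⋯ i n (i+1) ⋯ (n-1) 1 2`, with values and positions both
lowered by one: for `i = 2` the initial segment `3 4 ⋯ i` is empty, and for `i = n - 1` the
segment `(i+1) ⋯ (n-1)` is empty. -/
def vFun (n i : ℕ) (hi : 2 ≤ i) (hin : i ≤ n - 1) (p : Fin n) : Fin n :=
  if _h : (p : ℕ) < i - 2 then ⟨p + 2, by omega⟩
  else if (p : ℕ) = i - 2 then ⟨n - 1, by omega⟩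
  else if _h : (p : ℕ) < n - 2 then ⟨p + 1, by omega⟩
  else if (p : ℕ) = n - 2 then ⟨0, by omega⟩
  else ⟨1, by omega⟩

theorem vFun_injective (n i : ℕ) (hi : 2 ≤ i) (hin : i ≤ n - 1) :
    Function.Injective (vFun n i hi hin) := by
  intro p p' h
  have hp := p.isLt
  have hp' := p'.isLt
  apply Fin.ext
  unfold vFun at h
  split_ifs at h <;> simp only [Fin.mk.injEq] at h <;> omega

/-- The permutation `v_{n,i}` of `S_n`, for `2 ≤ i ≤ n - 1`. -/
noncomputable def vPerm (n i : ℕ) (hi : 2 ≤ i) (hin : i ≤ n - 1) : Equiv.Perm (Fin n) :=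
  Equiv.ofBijective _ (Finite.injective_iff_bijective.mp (vFun_injective n i hi hin))

end KLRTilde

/-! The operators `sigma j` satisfy the relations of the Hecke algebra of type A with quadratic
relation S² = 1 + qS. Applying the operator of a reduced word of v to the point mass at e and
evaluating at e gives R̃_{e,v}. This functional is a Markov trace (`isMarkovTrace_coeffOne`): it is
cyclic, and a generator that occurs once, with only smaller indices around it, can be deleted at the
cost of a factor q.

With indices from 0, v_{n,i} has the reduced expression (S_1⋯S_{n-2})(S_0⋯S_{n-3})(S_{n-4}⋯S_{i-2})
(`represents_asc_mul_asc_mul_desc`). Two deletions turn its trace into q² tr(c² · D), where c =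
S_0⋯S_{n-4} is a Coxeter element and D is the descending tail, of length n-i-1
(`tr_asc_one_mul_asc`).

Moving D past c raises its indices by one (`asc_mul_desc`). Together with S² = 1 + qS this yields a
Pascal-type recursion in the length of D, so the trace becomes a binomial sum of the traces t_m =
tr((S_0⋯S_{m-1})²) (`tr_sq_mul_desc`). The same method gives t_{m+2} = q²(t_{m+1} + t_m), with t_0 =
1 and t_1 = 1 + q², hence t_m = q^{2m} F_{m+1}(q^{-2}) (`toLaurent_coeffOne_sq`). -/

namespace KLRTilde

/-! ### Markov traces of squared Coxeter elements, abstractly -/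

section MarkovTrace

variable {K A : Type*} [CommRing K] [Ring A] [Algebra K A]

/-- The submonoid generated by the first `k` terms of a sequence. -/
def below (S : ℕ → A) (k : ℕ) : Submonoid A := Submonoid.closure (S '' Set.Iio k)

/-- The generators `S 0, …, S (N - 1)` satisfy the relations of the Hecke algebra of type `A_N`,
and `tr` is a Markov trace with parameter `q` on the monoid they generate. -/
structure IsMarkovTrace (N : ℕ) (q : K) (S : ℕ → A) (tr : A →ₗ[K] K) : Prop where
  mul_self : ∀ j < N, S j * S j = 1 + q • S j
  comm : ∀ j k, j + 1 < k → k < N → S j * S k = S k * S j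
  braid : ∀ j, j + 1 < N → S j * S (j + 1) * S j = S (j + 1) * S j * S (j + 1)
  map_one : tr 1 = 1
  cyclic : ∀ x ∈ below S N, ∀ y ∈ below S N, tr (x * y) = tr (y * x)
  markov : ∀ j < N, ∀ x ∈ below S j, ∀ y ∈ below S j, tr (x * S j * y) = q * tr (x * y)

theorem below_mono (S : ℕ → A) {k l : ℕ} (h : k ≤ l) : below S k ≤ below S l :=
  Submonoid.closure_mono (Set.image_mono (Set.Iio_subset_Iio h))

theorem mem_below (S : ℕ → A) {j k : ℕ} (h : j < k) : S j ∈ below S k :=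
  Submonoid.subset_closure ⟨j, h, rfl⟩

/-- The product `S a * S (a + 1) * ⋯ * S (a + k - 1)`. -/
def asc (S : ℕ → A) (a : ℕ) : ℕ → A
  | 0 => 1
  | k + 1 => asc S a k * S (a + k)

/-- The product `S (a + k - 1) * ⋯ * S (a + 1) * S a`. -/
def desc (S : ℕ → A) (a : ℕ) : ℕ → A
  | 0 => 1
  | k + 1 => S (a + k) * desc S a k

theorem asc_mem (S : ℕ → A) (a k l : ℕ) (h : a + k ≤ l) : asc S a k ∈ below S l := by
  induction k with
  | zero => exact one_mem _
  | succ k ih => exact mul_mem (ih (by omega)) (mem_below S (by omega))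

theorem desc_mem (S : ℕ → A) (a k l : ℕ) (h : a + k ≤ l) : desc S a k ∈ below S l := by
  induction k with
  | zero => exact one_mem _
  | succ k ih => exact mul_mem (mem_below S (by omega)) (ih (by omega))

theorem desc_succ_right (S : ℕ → A) (a k : ℕ) : desc S a (k + 1) = desc S (a + 1) k * S a := by
  induction k with
  | zero => simp [desc]
  | succ k ih => rw [desc, ih, desc, ← mul_assoc, add_right_comm, ← add_assoc]

namespace IsMarkovTrace

variable {N : ℕ} {q : K} {S : ℕ → A} {tr : A →ₗ[K] K}

theorem asc_mul_of_lt (H : IsMarkovTrace N q S tr) (m j : ℕ) (hm : m ≤ j) (hj : j + 1 < N) :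
    asc S 0 m * S (j + 1) = S (j + 1) * asc S 0 m := by
  induction m with
  | zero => simp [asc]
  | succ m ih =>
    rw [asc, zero_add, mul_assoc, H.comm m (j + 1) (by omega) hj, ← mul_assoc, ih (by omega),
      mul_assoc]

/-- Conjugation by a Coxeter element shifts indices: S_j commutes past the later letters, meets S_j
S_{j+1} in one braid move, and leaves it as S_{j+1}, which commutes past the earlier letters. -/
theorem asc_mul (H : IsMarkovTrace N q S tr) (m j : ℕ) (hj : j + 1 < m) (hm : m ≤ N) :
    asc S 0 m * S j = S (j + 1) * asc S 0 m := by
  induction m with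
  | zero => omega
  | succ m ih =>
    rcases (show j + 1 < m ∨ m = j + 1 by omega) with h | rfl
    · rw [asc, zero_add, mul_assoc, ← H.comm j m h (by omega), ← mul_assoc, ih h (by omega),
        mul_assoc]
    · rw [asc, asc, zero_add, zero_add, mul_assoc, mul_assoc, ← mul_assoc (S j),
        H.braid j (by omega), mul_assoc, ← mul_assoc, H.asc_mul_of_lt j j le_rfl (by omega)]
      simp only [mul_assoc]

theorem asc_mul_asc (H : IsMarkovTrace N q S tr) (m a k : ℕ) (h : a + k < m) (hm : m ≤ N) :
    asc S 0 m * asc S a k = asc S (a + 1) k * asc S 0 m := by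
  induction k with
  | zero => simp [asc]
  | succ k ih =>
    rw [asc, ← mul_assoc, ih (by omega), mul_assoc, H.asc_mul m _ (by omega) hm, asc,
      ← mul_assoc, add_right_comm]

theorem asc_mul_desc (H : IsMarkovTrace N q S tr) (m a k : ℕ) (h : a + k < m) (hm : m ≤ N) :
    asc S 0 m * desc S a k = desc S (a + 1) k * asc S 0 m := by
  induction k with
  | zero => simp [desc]
  | succ k ih =>
    rw [desc, ← mul_assoc, H.asc_mul m _ (by omega) hm, mul_assoc, ih (by omega), desc,
      ← mul_assoc, add_right_comm]

theorem asc_mul_last (H : IsMarkovTrace N q S tr) (m : ℕ) (hm : m < N) :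
    asc S 0 (m + 1) * S m = asc S 0 m + q • asc S 0 (m + 1) := by
  rw [asc, zero_add, mul_assoc, H.mul_self m hm, mul_add, mul_one, mul_smul_comm]

/-- The letter S_m occurs only once, so the Markov property deletes it. -/
theorem tr_asc_succ_mul (H : IsMarkovTrace N q S tr) (m : ℕ) (hm : m < N) {y : A}
    (hy : y ∈ below S m) :
    tr (asc S 0 (m + 1) * asc S 0 m * y) = q * tr (asc S 0 m * asc S 0 m * y) := by
  have h := asc_mem S 0 m m (by omega)
  rw [asc, zero_add, mul_assoc, H.markov m hm _ h _ (mul_mem h hy), ← mul_assoc]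

theorem tr_asc_one_mul (H : IsMarkovTrace N q S tr) (m : ℕ) (hm : m < N) {y : A}
    (hy : y ∈ below S m) :
    tr (asc S 1 m * asc S 0 (m + 1) * y) = q * tr (asc S 0 m * asc S 0 m * y) := by
  rw [← H.asc_mul_asc (m + 1) 0 m (by omega) hm, H.tr_asc_succ_mul m hm hy]

/-- Two deletions: S_{m+1} occurs only in the first factor; once it is gone, the index shift leaves
a single S_m. -/
theorem tr_asc_one_mul_asc (H : IsMarkovTrace N q S tr) (m : ℕ) (hm : m + 1 < N) {y : A}
    (hy : y ∈ below S m) :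
    tr (asc S 1 (m + 1) * asc S 0 (m + 1) * y) = q ^ 2 * tr (asc S 0 m * asc S 0 m * y) := by
  rw [asc, mul_assoc, add_comm 1 m, H.markov (m + 1) hm _ (asc_mem S 1 m _ (by omega)) _
    (mul_mem (asc_mem S 0 (m + 1) _ (by omega)) (below_mono S (by omega) hy)), ← mul_assoc,
    H.tr_asc_one_mul m (by omega) hy]
  ring

theorem tr_sq_zero (H : IsMarkovTrace N q S tr) : tr (asc S 0 0 * asc S 0 0) = 1 := by
  simp [asc, H.map_one]

theorem tr_sq_one (H : IsMarkovTrace N q S tr) (hN : 0 < N) :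
    tr (asc S 0 1 * asc S 0 1) = 1 + q ^ 2 := by
  have h := H.markov 0 hN 1 (one_mem _) 1 (one_mem _)
  simp only [one_mul, mul_one, H.map_one] at h
  simp [asc, H.mul_self 0 hN, H.map_one, h, sq]

theorem tr_sq_add_two (H : IsMarkovTrace N q S tr) (m : ℕ) (hm : m + 1 < N) :
    tr (asc S 0 (m + 2) * asc S 0 (m + 2)) =
      q ^ 2 * (tr (asc S 0 (m + 1) * asc S 0 (m + 1)) + tr (asc S 0 m * asc S 0 m)) := by
  have h1 : asc S 0 (m + 2) * asc S 0 (m + 2) =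
      asc S 1 (m + 1) * asc S 0 (m + 1) + q • (asc S 1 (m + 1) * asc S 0 (m + 2)) := by
    -- The last letter of the second factor is split off: the rest of that factor moves left through
    -- the first with its indices raised, and the letter then meets the quadratic relation.
    conv_lhs => rw [show asc S 0 (m + 2) * asc S 0 (m + 2) =
      asc S 0 (m + 2) * asc S 0 (m + 1) * S (m + 1) by rw [mul_assoc]; simp [asc]]
    rw [H.asc_mul_asc (m + 2) 0 (m + 1) (by omega) hm, mul_assoc, H.asc_mul_last (m + 1) hm,
      mul_add, mul_smul_comm]
  have h2 := H.tr_asc_one_mul_asc m hm (one_mem _)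
  have h3 := H.tr_asc_one_mul (m + 1) hm (one_mem _)
  simp only [mul_one] at h2 h3
  rw [h1, map_add, map_smul, h2, h3, smul_eq_mul]
  ring

/-- The first letter of the tail equals the last letter of c, so the quadratic relation splits the
product. In one term c loses that letter and the Markov property applies; in the other the remaining
tail passes one c with its indices raised, and cyclicity restores the shape c² times a tail. -/
theorem tr_sq_mul_desc_succ (H : IsMarkovTrace N q S tr) (a d : ℕ) (h : a + d < N) :
    tr (asc S 0 (a + d + 1) * asc S 0 (a + d + 1) * desc S a (d + 1)) =
      q * (tr (asc S 0 (a + d + 1) * asc S 0 (a + d + 1) * desc S (a + 1) d) +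
        tr (asc S 0 (a + d) * asc S 0 (a + d) * desc S a d)) := by
  have hc := asc_mem S 0 (a + d + 1) N (by omega)
  have hd := desc_mem S (a + 1) d N (by omega)
  have key : asc S 0 (a + d + 1) * asc S 0 (a + d + 1) * desc S a (d + 1) =
      asc S 0 (a + d + 1) * asc S 0 (a + d) * desc S a d +
        q • (asc S 0 (a + d + 1) * desc S (a + 1) d * asc S 0 (a + d + 1)) := by
    rw [mul_assoc _ (desc S (a + 1) d), ← H.asc_mul_desc (a + d + 1) a d (by omega) h, desc,
      ← mul_assoc, mul_assoc (asc S 0 (a + d + 1)), H.asc_mul_last _ h, mul_add, add_mul,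
      mul_smul_comm, smul_mul_assoc, mul_assoc (asc S 0 (a + d + 1)) (asc S 0 (a + d + 1))]
  rw [key, map_add, map_smul, H.tr_asc_succ_mul _ h (desc_mem S a d _ le_rfl),
    H.cyclic _ (mul_mem hc hd) _ hc, ← mul_assoc, smul_eq_mul]
  ring

theorem tr_sq_mul_desc (H : IsMarkovTrace N q S tr) (d : ℕ) : ∀ a, a + d ≤ N →
    tr (asc S 0 (a + d) * asc S 0 (a + d) * desc S a d) =
      q ^ d * ∑ k ∈ Finset.range (d + 1),
        (d.choose k : K) * tr (asc S 0 (a + d - k) * asc S 0 (a + d - k)) := by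
  induction d with
  | zero => intro a _; simp [desc]
  | succ d ih =>
    intro a h
    have h1 := ih (a + 1) (by omega)
    have h2 := ih a (by omega)
    rw [show a + 1 + d = a + d + 1 by omega] at h1
    rw [← add_assoc, H.tr_sq_mul_desc_succ a d (by omega), h1, h2,
      Finset.sum_range_succ' _ (d + 1), Finset.sum_range_succ' (fun k ↦ (d.choose k : K) * _) d]
    -- Pascal's rule merges the two sums; the k = 0 terms were split off so that the others line up
    -- after an index shift.
    simp only [Nat.choose_succ_succ, Nat.cast_add, add_mul, Finset.sum_add_distrib,
      Nat.add_sub_add_right]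
    rw [Finset.sum_range_succ (fun k ↦ (d.choose (k + 1) : K) * _) d]
    simp only [Nat.choose_succ_self, Nat.choose_zero_right, Nat.cast_zero]
    ring

end IsMarkovTrace

end MarkovTrace

end KLRTilde

namespace KLRTilde

open Polynomial MulOpposite

/-! ### Reduced words, one-line notation and R̃-polynomials -/

section Words

variable {n : ℕ}

/-- `w` is a reduced word whose product has one-line notation `f 0, f 1, …`. -/
def ReducedTo (w : List (Fin (n - 1))) (f : ℕ → ℕ) : Prop :=
  IsReducedExpr w (wordProd w) ∧ ∀ p : Fin n, (wordProd w p : ℕ) = f p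

theorem reducedTo_nil : ReducedTo ([] : List (Fin (n - 1))) id := by
  refine ⟨⟨rfl, ?_⟩, fun p ↦ rfl⟩
  exact (Nat.le_zero.mp (length_le [])).symm

theorem ReducedTo.concat {w : List (Fin (n - 1))} {f g : ℕ → ℕ} (h : ReducedTo w f)
    (j : Fin (n - 1)) (hj : f j < f (j + 1))
    (hg : ∀ p < n, g p = if p = j then f (j + 1) else if p = j + 1 then f j else f p) :
    ReducedTo (w ++ [j]) g := by
  have hlt : wordProd w (lo j) < wordProd w (hi j) := by
    rw [Fin.lt_def, h.2, h.2]; exact hj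
  refine ⟨?_, fun p ↦ ?_⟩
  · refine IsReducedExpr.concat (j := j) ?_ ?_
    · rw [wordProd_concat, mul_simple_cancel]; exact h.1
    · rw [IsDescent, wordProd_concat, mul_simple_cancel]; exact lt_length_of_lt hlt
  · rw [wordProd_concat, Equiv.Perm.mul_apply, h.2, hg p p.isLt, simple_eq,
      Equiv.swap_apply_def]
    simp only [Fin.ext_iff, lo, hi]
    split_ifs <;> rfl

/-- This plays the role of Matsumoto's theorem: commutation and braid relations reduce to comparing
one-line notations. -/
theorem ReducedTo.sigmaWord_eq {w w' : List (Fin (n - 1))} {f : ℕ → ℕ} (h : ReducedTo w f)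
    (h' : ReducedTo w' f) : sigmaWord w = sigmaWord w' := by
  refine KLRTilde.sigmaWord_eq h.1 (v := wordProd w) ?_
  have : wordProd w = wordProd w' := Equiv.ext fun p ↦ Fin.ext (by rw [h.2, h'.2])
  rw [this]
  exact h'.1

/-- A family of `R̃`-polynomials is computed by any reduced word. -/
theorem IsRTildeFamily.eq_sigmaWord {R : Equiv.Perm (Fin n) → Equiv.Perm (Fin n) → ℤ[X]}
    (hR : IsRTildeFamily R) (w : List (Fin (n - 1))) : ∀ u v, IsReducedExpr w v →
      R u v = sigmaWord w (pt 1) u := by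
  induction w using List.reverseRecOn with
  | nil =>
    intro u v hv
    have hv1 : v = 1 := hv.1.symm
    subst hv1
    by_cases hu : u = 1
    · subst hu; rw [hR.self]; simp [sigmaWord, pt]
    · rw [hR.eq_zero]
      · simp [sigmaWord, pt, hu]
      · intro hle
        obtain ⟨w', hs, hr⟩ := hle _ hv
        rw [List.sublist_nil] at hs
        subst hs
        exact hu hr.1.symm
  | append_singleton w j ih =>
    intro u v hv
    by_cases hle : BruhatLE u v
    · obtain ⟨h1, h2⟩ := hv.of_concat
      rw [sigmaWord_concat, Module.End.mul_apply, sigma_apply, ← ih _ _ h1, ← ih _ _ h1]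
      by_cases hu : IsDescent u j
      · rw [hR.of_descent u v j hle h2 hu, if_pos ((isDescent_iff _ _).mp hu), add_zero]
      · rw [hR.of_not_descent u v j hle h2 hu, if_neg (mt (isDescent_iff _ _).mpr hu)]
    · rw [hR.eq_zero u v hle]
      by_contra h0
      refine hle fun w' hw' ↦ ?_
      rw [KLRTilde.sigmaWord_eq hv hw'] at h0
      exact sigmaWord_support w' u (Ne.symm h0)

theorem RTilde_eq_sigmaWord {w : List (Fin (n - 1))} {v : Equiv.Perm (Fin n)}
    (h : IsReducedExpr w v) (u : Equiv.Perm (Fin n)) : RTilde u v = sigmaWord w (pt 1) u :=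
  (existsUnique_isRTildeFamily n).exists.choose_spec.eq_sigmaWord w u v h

end Words

/-! ### The identity coefficient as a Markov trace -/

section Trace

variable {n : ℕ}

/-- The generators of the Hecke algebra, acting from the right through `sigma`. -/
noncomputable def gen (n : ℕ) (j : ℕ) : (Module.End ℤ[X] (Equiv.Perm (Fin n) → ℤ[X]))ᵐᵒᵖ :=
  if h : j < n - 1 then op (sigma ⟨j, h⟩) else 1

theorem gen_coe (j : Fin (n - 1)) : gen n j = op (sigma j) := by simp [gen]

/-- The coefficient at the identity of the image of the point mass at the identity. -/
noncomputable def coeffOne (n : ℕ) :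
    (Module.End ℤ[X] (Equiv.Perm (Fin n) → ℤ[X]))ᵐᵒᵖ →ₗ[ℤ[X]] ℤ[X] where
  toFun x := unop x (pt 1) 1
  map_add' _ _ := rfl
  map_smul' _ _ := rfl

theorem coeffOne_op (x : Module.End ℤ[X] (Equiv.Perm (Fin n) → ℤ[X])) :
    coeffOne n (op x) = x (pt 1) 1 := rfl

theorem op_sigmaWord_concat (w : List (Fin (n - 1))) (j : Fin (n - 1)) :
    op (sigmaWord (w ++ [j])) = op (sigmaWord w) * gen n j := by
  rw [sigmaWord_concat, op_mul, gen_coe]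

theorem op_sigmaWord_nil : op (sigmaWord ([] : List (Fin (n - 1)))) = 1 := rfl

theorem op_sigmaWord_append (w w' : List (Fin (n - 1))) :
    op (sigmaWord (w ++ w')) = op (sigmaWord w) * op (sigmaWord w') := by
  simp [sigmaWord]

/-- Since `tau j` is the inverse of `sigma j`, this is the quadratic relation in the form S = S⁻¹ +
q. -/
theorem sigma_eq_tau_add (j : Fin (n - 1)) :
    sigma (n := n) j = tau j + (X : ℤ[X]) • (1 : Module.End ℤ[X] _) := by
  refine LinearMap.ext fun f ↦ funext fun u ↦ ?_
  simp only [LinearMap.add_apply, LinearMap.smul_apply, Module.End.one_apply, Pi.add_apply,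
    Pi.smul_apply, smul_eq_mul, sigma_apply, tau_apply]
  split_ifs <;> ring

/-- The analogue of `sigma` for left multiplication. -/
noncomputable def sigmaLeft (j : Fin (n - 1)) :
    Module.End ℤ[X] (Equiv.Perm (Fin n) → ℤ[X]) := mu j + (X : ℤ[X]) • 1

theorem sigmaLeft_apply (j : Fin (n - 1)) (f : Equiv.Perm (Fin n) → ℤ[X]) (u) :
    sigmaLeft j f u = f (simple j * u) + if u⁻¹ (hi j) < u⁻¹ (lo j) then 0 else X * f u := by
  simp only [sigmaLeft, LinearMap.add_apply, LinearMap.smul_apply, Module.End.one_apply,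
    Pi.add_apply, Pi.smul_apply, smul_eq_mul, mu_apply]
  split_ifs <;> ring

theorem commute_sigma_sigmaLeft (a b : Fin (n - 1)) :
    Commute (sigma (n := n) b) (sigmaLeft a) := by
  rw [sigma_eq_tau_add, sigmaLeft]
  exact ((commute_tau_mu a b).add_left ((Commute.one_left _).smul_left _)).add_right
    ((Commute.one_right _).smul_right _)

theorem commute_sigmaWord_sigmaLeft (w : List (Fin (n - 1))) (a : Fin (n - 1)) :
    Commute (sigmaWord w) (sigmaLeft a) := by
  refine Commute.list_prod_left _ _ fun x hx ↦ ?_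
  obtain ⟨j, _, rfl⟩ := List.mem_map.mp hx
  exact commute_sigma_sigmaLeft a j

theorem sigmaLeft_pt_one (j : Fin (n - 1)) : sigmaLeft j (pt 1) = sigma (n := n) j (pt 1) := by
  funext u
  rw [sigmaLeft_apply, sigma_apply]
  by_cases hu : u = 1
  · subst hu; simp [lo_lt_hi j |>.not_gt]
  · have h : simple j * u = 1 ↔ u * simple j = 1 := by
      rw [mul_eq_one_iff_eq_inv', mul_eq_one_iff_eq_inv]
    simp [pt, Pi.single_apply, hu, h]

theorem sigmaLeft_apply_one (j : Fin (n - 1)) (f : Equiv.Perm (Fin n) → ℤ[X]) :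
    sigmaLeft j f 1 = sigma j f 1 := by
  have h : ¬ (1 : Equiv.Perm (Fin n)) (hi j) < (1 : Equiv.Perm (Fin n)) (lo j) := (lo_lt_hi j).not_gt
  rw [sigmaLeft_apply, sigma_apply, mul_one, one_mul, inv_one, if_neg h]

/-- The left and right operators agree on the point mass at e and under evaluation at e. A letter at
one end of the product can thus become a left operator, commute past the word, and become a right
operator at the other end. -/
theorem coeffOne_mul_sigma (w : List (Fin (n - 1))) (j : Fin (n - 1)) :
    coeffOne n (op (sigmaWord w) * op (sigma j)) = coeffOne n (op (sigma j) * op (sigmaWord w)) := by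
  rw [← op_mul, ← op_mul, coeffOne_op, coeffOne_op, Module.End.mul_apply, Module.End.mul_apply,
    ← sigmaLeft_apply_one, ← sigmaLeft_pt_one, ← Module.End.mul_apply, ← Module.End.mul_apply,
    (commute_sigmaWord_sigmaLeft w j).eq]

theorem coeffOne_mul_comm (w w' : List (Fin (n - 1))) :
    coeffOne n (op (sigmaWord w) * op (sigmaWord w')) =
      coeffOne n (op (sigmaWord w') * op (sigmaWord w)) := by
  induction w' using List.reverseRecOn generalizing w with
  | nil => simp [op_sigmaWord_nil]
  | append_singleton w' j ih =>
    rw [op_sigmaWord_concat, ← mul_assoc, ← op_sigmaWord_append, gen_coe, coeffOne_mul_sigma,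
      op_sigmaWord_append, ← mul_assoc, mul_assoc _ (op (sigma j)), ← gen_coe]
    -- After one cyclic move the letter j stands in front of `w`, which is why the induction
    -- generalizes `w`.
    have := ih ([j] ++ w)
    rw [op_sigmaWord_append, ← List.nil_append [j], op_sigmaWord_concat, op_sigmaWord_nil,
      one_mul] at this
    rw [mul_assoc] at this ⊢
    exact this

theorem exists_word_of_mem_below {k : ℕ} {x} (hx : x ∈ below (gen n) k) :
    ∃ w : List (Fin (n - 1)), (∀ j ∈ w, (j : ℕ) < k) ∧ x = op (sigmaWord w) := by
  induction hx using Submonoid.closure_induction with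
  | mem x hx =>
    obtain ⟨j, hj, rfl⟩ := hx
    by_cases h : j < n - 1
    · exact ⟨[⟨j, h⟩], by simpa using hj, by simp [gen, h, sigmaWord]⟩
    · exact ⟨[], by simp, by simp [gen, h, sigmaWord]⟩
  | one => exact ⟨[], by simp, rfl⟩
  | mul x y _ _ hx hy =>
    obtain ⟨a, ha, rfl⟩ := hx
    obtain ⟨b, hb, rfl⟩ := hy
    refine ⟨a ++ b, fun j hj ↦ ?_, (op_sigmaWord_append a b).symm⟩
    rcases List.mem_append.mp hj with h | h
    exacts [ha j h, hb j h]

/-- The support consists of products of subwords, and a subword of length at most one that avoids j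
cannot give s_j. -/
theorem sigmaWord_simple_eq_zero (w : List (Fin (n - 1))) (j : Fin (n - 1)) (h : j ∉ w) :
    sigmaWord w (pt 1) (simple j) = 0 := by
  by_contra h0
  obtain ⟨w', hs, hp, hl⟩ := sigmaWord_support w _ h0
  have hlo : wordProd w' (lo j) = hi j := by rw [hp, simple_lo]
  have h1 : w'.length ≤ 1 := by
    rw [hl]
    simpa [wordProd] using length_le [j]
  match w', h1 with
  | [], _ => exact (lo_lt_hi j).ne hlo
  | [k], _ =>
    have hk : k ≠ j := fun hk ↦ h (hs.subset (by simp [hk]))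
    rw [wordProd_cons, wordProd_nil, mul_one, simple_eq, Equiv.swap_apply_def] at hlo
    simp only [Fin.ext_iff, lo, hi, ne_eq] at hlo hk
    split_ifs at hlo <;> simp at hlo <;> omega

theorem coeffOne_sigmaWord_mul_gen (w : List (Fin (n - 1))) (j : Fin (n - 1)) (h : j ∉ w) :
    coeffOne n (op (sigmaWord w) * gen n j) = X * coeffOne n (op (sigmaWord w)) := by
  rw [gen_coe, ← op_mul, coeffOne_op, coeffOne_op, Module.End.mul_apply, sigma_apply, one_mul,
    sigmaWord_simple_eq_zero w j h, if_neg (by simpa using (lo_lt_hi j).le), zero_add]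

theorem gen_word_two (j k : Fin (n - 1)) : gen n j * gen n k = op (sigmaWord [j, k]) := by
  rw [gen_coe, gen_coe, ← op_mul]; simp [sigmaWord]

theorem gen_word_three (j k l : Fin (n - 1)) :
    gen n j * gen n k * gen n l = op (sigmaWord [j, k, l]) := by
  rw [gen_word_two, ← op_sigmaWord_concat]; rfl

theorem isMarkovTrace_coeffOne (n : ℕ) :
    IsMarkovTrace (n - 1) (X : ℤ[X]) (gen n) (coeffOne n) where
  mul_self j hj := by
    have h : sigma (n := n) ⟨j, hj⟩ * sigma ⟨j, hj⟩ = 1 + (X : ℤ[X]) • sigma ⟨j, hj⟩ := by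
      conv_lhs => enter [1]; rw [sigma_eq_tau_add]
      rw [add_mul, tau_sigma, smul_mul_assoc, one_mul]
    have := congrArg op h
    rw [op_mul, op_add, op_one, op_smul] at this
    simpa [gen, hj] using this
  comm j k hjk hk := by
    have h1 : ReducedTo [(⟨j, by omega⟩ : Fin (n - 1)), ⟨k, hk⟩] _ :=
      (reducedTo_nil.concat ⟨j, by omega⟩ (by simp) (fun _ _ ↦ rfl)).concat ⟨k, hk⟩
        (by dsimp; split_ifs <;> omega) (fun _ _ ↦ rfl)
    have h2 : ReducedTo [(⟨k, hk⟩ : Fin (n - 1)), ⟨j, by omega⟩] _ :=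
      (reducedTo_nil.concat ⟨k, hk⟩ (by simp) (fun _ _ ↦ rfl)).concat ⟨j, by omega⟩
        (by dsimp; split_ifs <;> omega) (fun p _ ↦ rfl)
    have h := gen_word_two (⟨j, by omega⟩ : Fin (n - 1)) ⟨k, hk⟩
    rw [h1.sigmaWord_eq (w' := [⟨k, hk⟩, ⟨j, by omega⟩]) ?_, ← gen_word_two] at h
    · exact h
    · convert h2 using 1
      funext p
      dsimp
      split_ifs <;> omega
  braid j hj := by
    have h1 : ReducedTo [(⟨j, by omega⟩ : Fin (n - 1)), ⟨j + 1, hj⟩, ⟨j, by omega⟩] _ :=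
      ((reducedTo_nil.concat ⟨j, by omega⟩ (by simp) (fun _ _ ↦ rfl)).concat ⟨j + 1, hj⟩
        (by dsimp; split_ifs <;> omega) (fun _ _ ↦ rfl)).concat ⟨j, by omega⟩
        (by dsimp; split_ifs <;> omega) (fun _ _ ↦ rfl)
    have h2 : ReducedTo [(⟨j + 1, hj⟩ : Fin (n - 1)), ⟨j, by omega⟩, ⟨j + 1, hj⟩] _ :=
      ((reducedTo_nil.concat ⟨j + 1, hj⟩ (by simp) (fun _ _ ↦ rfl)).concat ⟨j, by omega⟩
        (by dsimp; split_ifs <;> omega) (fun _ _ ↦ rfl)).concat ⟨j + 1, hj⟩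
        (by dsimp; split_ifs <;> omega) (fun _ _ ↦ rfl)
    have h := gen_word_three (⟨j, by omega⟩ : Fin (n - 1)) ⟨j + 1, hj⟩ ⟨j, by omega⟩
    rw [h1.sigmaWord_eq (w' := [⟨j + 1, hj⟩, ⟨j, by omega⟩, ⟨j + 1, hj⟩]) ?_,
      ← gen_word_three] at h
    · exact h
    · convert h2 using 1
      funext p
      dsimp
      split_ifs <;> omega
  map_one := by
    rw [← op_one, coeffOne_op]; simp [pt]
  cyclic x hx y hy := by
    obtain ⟨a, _, rfl⟩ := exists_word_of_mem_below hx
    obtain ⟨b, _, rfl⟩ := exists_word_of_mem_below hy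
    exact coeffOne_mul_comm a b
  markov j hj x hx y hy := by
    obtain ⟨a, ha, rfl⟩ := exists_word_of_mem_below hx
    obtain ⟨b, hb, rfl⟩ := exists_word_of_mem_below hy
    -- Cyclicity brings the letter j to the end of the word, where it contributes a factor X because
    -- it occurs nowhere else.
    have h1 := coeffOne_mul_comm (a ++ [⟨j, hj⟩]) b
    have h2 := coeffOne_sigmaWord_mul_gen (b ++ a) ⟨j, hj⟩ fun hc ↦ by
      rcases List.mem_append.mp hc with h | h
      exacts [lt_irrefl _ (hb _ h), lt_irrefl _ (ha _ h)]
    rw [op_sigmaWord_concat, ← mul_assoc, ← op_sigmaWord_append] at h1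
    rw [h1, h2, op_sigmaWord_append, coeffOne_mul_comm]

end Trace

/-! ### A reduced word for v_{n,i} and the Fibonacci evaluation -/

section OneLine

variable {n : ℕ}

/-- `x` is the operator of a reduced word whose product has one-line notation `f 0, f 1, …`. -/
def Represents (n : ℕ) (x : (Module.End ℤ[X] (Equiv.Perm (Fin n) → ℤ[X]))ᵐᵒᵖ) (f : ℕ → ℕ) : Prop :=
  ∃ w : List (Fin (n - 1)), ReducedTo w f ∧ op (sigmaWord w) = x

theorem represents_one : Represents n 1 id := ⟨[], reducedTo_nil, rfl⟩

theorem Represents.mul_gen {x} {f : ℕ → ℕ} (h : Represents n x f) (g : ℕ → ℕ) (j : ℕ)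
    (hj : j < n - 1) (hlt : f j < f (j + 1))
    (hg : ∀ p < n, g p = if p = j then f (j + 1) else if p = j + 1 then f j else f p) :
    Represents n (x * gen n j) g := by
  obtain ⟨w, hw, rfl⟩ := h
  exact ⟨w ++ [⟨j, hj⟩], hw.concat ⟨j, hj⟩ hlt hg, op_sigmaWord_concat w ⟨j, hj⟩⟩

theorem Represents.RTilde_one {x} {f : ℕ → ℕ} (h : Represents n x f) (v : Equiv.Perm (Fin n))
    (hv : ∀ p, (v p : ℕ) = f p) : RTilde 1 v = coeffOne n x := by
  obtain ⟨w, hw, rfl⟩ := h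
  have : wordProd w = v := Equiv.ext fun p ↦ Fin.ext (by rw [hw.2, hv])
  rw [RTilde_eq_sigmaWord (this ▸ hw.1) 1, coeffOne_op]

theorem represents_asc_one (k : ℕ) (hk : k + 1 < n) :
    Represents n (asc (gen n) 1 k)
      (fun p ↦ if p = 0 then 0 else if p ≤ k then p + 1 else if p = k + 1 then 1 else p) := by
  induction k with
  | zero =>
    rw [asc]
    convert represents_one (n := n) using 1
    funext p
    dsimp
    split_ifs <;> omega
  | succ k ih =>
    refine (ih (by omega)).mul_gen _ (1 + k) (by omega) ?_ fun p hp ↦ ?_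
    · dsimp; split_ifs <;> omega
    · split_ifs <;> omega

/-- Each new letter moves the entry 0 one place to the right, past a larger entry. The values at p ≥
n only serve to make the functions agree on all of ℕ. -/
theorem represents_asc_mul_asc (k : ℕ) (hk : k + 1 < n) :
    Represents n (asc (gen n) 1 (n - 2) * asc (gen n) 0 k)
      (fun p ↦ if p < k then p + 2 else if p = k then 0 else if p < n - 1 then p + 1 else
        if p = n - 1 then 1 else p) := by
  induction k with
  | zero =>
    rw [asc, mul_one]
    convert represents_asc_one (n := n) (n - 2) (by omega) using 1
    funext p
    split_ifs <;> omega
  | succ k ih =>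
    rw [asc, ← mul_assoc]
    refine (ih (by omega)).mul_gen _ (0 + k) (by omega) ?_ fun p hp ↦ ?_
    · split_ifs <;> omega
    · split_ifs <;> omega

/-- Each letter of the tail moves the entry n - 1 one place to the left, so the tail is built up
from its right end. -/
theorem represents_asc_mul_asc_mul_desc (d : ℕ) : ∀ a, a + d + 3 = n →
    Represents n (asc (gen n) 1 (n - 2) * asc (gen n) 0 (n - 2) * desc (gen n) a d)
      (fun p ↦ if p < a then p + 2 else if p = a then n - 1 else if p < n - 2 then p + 1 else
        if p = n - 2 then 0 else if p = n - 1 then 1 else p) := by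
  induction d with
  | zero =>
    intro a h
    rw [desc, mul_one]
    convert represents_asc_mul_asc (n := n) (n - 2) (by omega) using 1
    funext p
    split_ifs <;> omega
  | succ d ih =>
    intro a h
    rw [desc_succ_right, ← mul_assoc]
    refine (ih (a + 1) (by omega)).mul_gen _ a (by omega) ?_ fun p hp ↦ ?_
    · split_ifs <;> omega
    · split_ifs <;> omega

theorem vPerm_apply (i : ℕ) (hi : 2 ≤ i) (hin : i ≤ n - 1) (p : Fin n) :
    (vPerm n i hi hin p : ℕ) = if (p : ℕ) < i - 2 then (p : ℕ) + 2 else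
      if (p : ℕ) = i - 2 then n - 1 else if (p : ℕ) < n - 2 then p + 1 else
        if (p : ℕ) = n - 2 then 0 else if (p : ℕ) = n - 1 then 1 else p := by
  have hp := p.isLt
  show (vFun n i hi hin p : ℕ) = _
  unfold vFun
  split_ifs <;> first | rfl | omega

/-- The exponent n - i + 1 is 2 from the two Markov deletions plus the tail length n - i - 1. -/
theorem RTilde_one_vPerm (i : ℕ) (hi : 2 ≤ i) (hin : i ≤ n - 1) :
    RTilde 1 (vPerm n i hi hin) = X ^ (n - i + 1) * ∑ k ∈ Finset.range (n - i - 1 + 1),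
      ((n - i - 1).choose k : ℤ[X]) *
        coeffOne n (asc (gen n) 0 (n - 3 - k) * asc (gen n) 0 (n - 3 - k)) := by
  have H := isMarkovTrace_coeffOne n
  rw [(represents_asc_mul_asc_mul_desc (n - i - 1) (i - 2) (by omega)).RTilde_one _
    (vPerm_apply i hi hin), show n - 2 = n - 3 + 1 by omega,
    H.tr_asc_one_mul_asc (n - 3) (by omega) (desc_mem _ _ _ _ (by omega)),
    show n - 3 = i - 2 + (n - i - 1) by omega, H.tr_sq_mul_desc _ _ (by omega), ← mul_assoc,
    ← pow_add, show 2 + (n - i - 1) = n - i + 1 by omega]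

theorem qFib_add_two (m : ℕ) : qFib (m + 2) = qFib (m + 1) + X * qFib m := by rw [qFib]

theorem toLaurent_coeffOne_sq (m : ℕ) (hm : m < n) :
    toLaurent (coeffOne n (asc (gen n) 0 m * asc (gen n) 0 m)) =
      LaurentPolynomial.T (2 * m : ℤ) *
        aeval (LaurentPolynomial.T (-2) : LaurentPolynomial ℤ) (qFib (m + 1)) := by
  have H := isMarkovTrace_coeffOne n
  induction m using Nat.twoStepInduction with
  | zero => rw [H.tr_sq_zero]; simp [qFib]
  | one =>
    rw [H.tr_sq_one (by omega)]
    simp only [qFib, map_add, map_one, aeval_X, toLaurent_X_pow, mul_add, mul_one,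
      Nat.cast_one, ← LaurentPolynomial.T_add]
    rw [add_comm]
    norm_num
  | more m ih1 ih2 =>
    rw [H.tr_sq_add_two m (by omega), map_mul, map_add, ih1 (by omega), ih2 (by omega),
      show m + 2 + 1 = m + 1 + 2 by omega, qFib_add_two (m + 1)]
    simp only [map_add, map_mul, aeval_X, toLaurent_X_pow, mul_add, ← mul_assoc,
      ← LaurentPolynomial.T_add]
    congr 3
    · push_cast; ring
    · push_cast; ring

end OneLine

end KLRTilde

theorem theorem2p4 (n i : ℕ) (hn : 3 ≤ n) (hi : 2 ≤ i) (hin : i ≤ n - 1) :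
    Polynomial.toLaurent (KLRTilde.RTilde 1 (KLRTilde.vPerm n i hi hin)) =
      ∑ k ∈ Finset.range (n - i - 1 + 1),
        LaurentPolynomial.T (3 * (n : ℤ) - i - 2 * k - 5) *
          ((n - i - 1).choose k : LaurentPolynomial ℤ) *
          Polynomial.aeval (LaurentPolynomial.T (-2) : LaurentPolynomial ℤ)
            (KLRTilde.qFib (n - k - 2)) := by
  rw [KLRTilde.RTilde_one_vPerm, map_mul, map_sum, Finset.mul_sum]
  refine Finset.sum_congr rfl fun k hk ↦ ?_
  have hk' := Finset.mem_range.mp hk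
  rw [map_mul, KLRTilde.toLaurent_coeffOne_sq _ (by omega), Polynomial.toLaurent_X_pow,
    map_natCast, show n - 3 - k + 1 = n - k - 2 by omega,
    -- The prefactor contributes n - i + 1 and t_{n-3-k} contributes 2(n - 3 - k); the truncated
    -- subtractions are exact because k ≤ n - i - 1 ≤ n - 3.
    show (3 * (n : ℤ) - i - 2 * k - 5) = ((n - i + 1 : ℕ) : ℤ) + 2 * ((n - 3 - k : ℕ) : ℤ) by omega,
    LaurentPolynomial.T_add]
  ring
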